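/- Let $\Sigma$ be a finite alphabet with $k\ge 2$ symbols, $\Sigma^*$ the set of finite strings and $\Sigma^\infty$ the set of infinite sequences over $\Sigma$; $S\upharpoonright n$ is the string of the first $n$ symbols of a sequence $S$, and $\log$ is the logarithm to base $2$. For $S\in\Sigma^\infty$, $\ell,n\ge 1$ and $x\in\Sigma^\ell$ let $$\pi_{S,n}(x)=\frac1n\,\bigl|\{m : 0\le m<n,\ S[m\ell]\,S[m\ell+1]\cdots S[(m+1)\ell-1]=x\}\bigr|,$$ where the symbols of $S$ are indexed from $0$. For a probability measure $\alpha$ on $\Sigma$, the sequence $S$ is *$\alpha$-normal* if $\lim_{n\to\infty}\pi_{S,n}(x)=\prod_{i=0}^{\ell-1}\alpha(x[i])$ for every $\ell\ge1$ and every $x\in\Sigma^\ell$; the same definition is used over the alphabet $\Sigma\times\Sigma$. The measure $\alpha$ is *positive* if $\alpha(a)>0$ for all $a\in\Sigma$. An *information-lossless finite-state compressor* with $r$ states on an alphabet $X$ is a tuple $C=(Q,\delta,\nu,q_0)$ with $|Q|=r$, $\delta:Q\times X\to Q$, $\nu:Q\times X\to\{0,1\}^*$ and $q_0\in Q$, such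 that $u\mapsto (C(u),\delta^*(u))$ is one-to-one on $X^*$, where $\delta^*(u)$ is the state reached from $q_0$ after reading $u$ and $C(u)$ is the concatenation of the strings output along the way. For $u,w\in\Sigma^n$ write $(u,w)\in(\Sigma\times\Sigma)^n$ for the string of pairs, and put $$\rho_r(u)=\min_C\frac{|C(u)|}{n\log k},\qquad \rho_r(u,w)=\min_C\frac{|C((u,w))|}{n\log k},$$ the minima being over information-lossless finite-state compressors with $r$ states on $\Sigma$ and on $\Sigma\times\Sigma$, respectively. Let $\rho_{r,t}(u:w)=\rho_t(u)+\rho_t(w)-\rho_r(u,w)$. The *upper finite-state mutual dimension* between $S,T\in\Sigma^\infty$ is $$Mdim_{FS}(S:T)=\lim_{r\to\infty}\lim_{t\to\infty}\limsup_{n\to\infty}\rho_{r,t}(S\upharpoonright n:T\upharpoonright n).$$ **Theorem.** Let $\alpha_1$ and $\alpha_2$ be positive probability measures on $\Sigma$, let $R_1\in\Sigma^\infty$ be $\alpha_1$-normal and let $R_2\in\Sigma^\infty$ be $\alpha_2$-normal. Then the sequence of pairs $(R_1,R_2)\in(\Sigma\times\Sigma)^\infty$ is $(\alpha_1\times\alpha_2)$-normal,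 where $(\alpha_1\times\alpha_2)(a,b)=\alpha_1(a)\alpha_2(b)$, if and only if $Mdim_{FS}(R_1:R_2)=0$. -/

import Mathlib

open Filter Topology

noncomputable section

namespace FSMutual

/-- A finite-state compressor with `r` states on the input alphabet `A`, with binary output.
The state set is taken to be `Fin r`; it is nonempty because it contains `start`. -/
structure FSC (A : Type*) (r : ℕ) where
  /-- transition function -/
  step : Fin r → A → Fin r
  /-- output function -/
  out : Fin r → A → List Bool
  /-- initial state -/
  start : Fin r

namespace FSC

variable {A : Type*} {r : ℕ}

/-- Extended transition function: the state reached from `q` after reading `u`. -/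
def stateFrom (C : FSC A r) : Fin r → List A → Fin r
  | q, [] => q
  | q, a :: u => C.stateFrom (C.step q a) u

/-- The string that is output while reading `u` from state `q`. -/
def outputFrom (C : FSC A r) : Fin r → List A → List Bool
  | _, [] => []
  | q, a :: u => C.out q a ++ C.outputFrom (C.step q a) u

/-- The output `C(u)` on input `u`. -/
def output (C : FSC A r) (u : List A) : List Bool := C.outputFrom C.start u

/-- The state reached from the initial state after reading `u`. -/
def finalState (C : FSC A r) (u : List A) : Fin r := C.stateFrom C.start u

/-- `C` is information-lossless: output and final state together determine the input. -/
def IsLossless (C : FSC A r) : Prop :=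
  Function.Injective fun u : List A => (C.output u, C.finalState u)

end FSC

section Ratios

variable {A : Type*} [Fintype A]

/-- `n log k` for an alphabet `A` of `k` symbols (logarithm to base 2). -/
def normalizer (A : Type*) [Fintype A] (n : ℕ) : ℝ := (n : ℝ) * Real.logb 2 (Fintype.card A)

/-- The compression ratio `ρ_C(u) = |C(u)| / (n log k)` of a string `u` of length `n`. -/
def ratio {r : ℕ} (C : FSC A r) (u : List A) : ℝ :=
  ((C.output u).length : ℝ) / normalizer A u.length

/-- The joint compression ratio `ρ_C(u,w) = |C((u,w))| / (n log k)` of two strings `u`, `w` of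
the same length `n`, where `C` reads pairs of symbols. Note that the normalization uses
`k = |A|`, not `|A × A|`. -/
def jointRatio {r : ℕ} (C : FSC (A × A) r) (u w : List A) : ℝ :=
  ((C.output (u.zip w)).length : ℝ) / normalizer A u.length

/-- The `r`-state compression ratio of a string: the minimum of `ρ_C(u)` over all
information-lossless compressors `C` with `r` states. -/
def rho (r : ℕ) (u : List A) : ℝ :=
  sInf {x : ℝ | ∃ C : FSC A r, C.IsLossless ∧ x = ratio C u}

/-- The `r`-state joint compression ratio of two strings of the same length: the minimum of
`ρ_C(u,w)` over all information-lossless compressors `C` on pairs with `r` states. -/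
def jointRho (r : ℕ) (u w : List A) : ℝ :=
  sInf {x : ℝ | ∃ C : FSC (A × A) r, C.IsLossless ∧ x = jointRatio C u w}

/-- The `r,t`-state mutual compression ratio `ρ_{r,t}(u:w) = ρ_t(u) + ρ_t(w) - ρ_r(u,w)` of two
strings of the same length. -/
def mutualRho (r t : ℕ) (u w : List A) : ℝ := rho t u + rho t w - jointRho r u w

/-- The prefix consisting of the first `n` symbols of a sequence. -/
def pre {A : Type*} (S : ℕ → A) (n : ℕ) : List A := (List.range n).map S

/-- The upper `r,t`-state mutual compression ratio between two sequences. -/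
def upperMutualRho (r t : ℕ) (S T : ℕ → A) : ℝ :=
  limsup (fun n => mutualRho r t (pre S n) (pre T n)) atTop

/-- The inner limit `lim_{t → ∞}` in the definition of the upper mutual dimension; it exists by
`tendsto_innerUpper` below. -/
def innerUpper (S T : ℕ → A) (r : ℕ) : ℝ :=
  limUnder atTop fun t => upperMutualRho r t S T

/-- The upper finite-state mutual dimension
`Mdim_FS(S:T) = lim_{r → ∞} lim_{t → ∞} limsup_{n → ∞} ρ_{r,t}(S ↾ n : T ↾ n)`; the
limits exist by `tendsto_innerUpper` and `tendsto_upperMutualDim` below. -/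
def upperMutualDim (S T : ℕ → A) : ℝ := limUnder atTop (innerUpper S T)

end Ratios

section Normality

/-- The frequency, among the first `n` aligned blocks of length `ℓ` of the sequence `S`, of the
block `x`. -/
def blockFreq {A : Type*} {ℓ : ℕ} (S : ℕ → A) (n : ℕ) (x : Fin ℓ → A) : ℝ :=
  (Set.ncard {m : ℕ | m < n ∧ ∀ i : Fin ℓ, S (m * ℓ + i) = x i} : ℝ) / n

/-- `S` is `α`-`ℓ`-normal: every block `x` of length `ℓ` has limiting aligned frequency
`α(x) = α(x[0]) ⋯ α(x[ℓ-1])`. -/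
def IsBlockNormal {A : Type*} (α : A → ℝ) (ℓ : ℕ) (S : ℕ → A) : Prop :=
  ∀ x : Fin ℓ → A, Tendsto (fun n => blockFreq S n x) atTop (𝓝 (∏ i, α (x i)))

/-- `S` is `α`-normal: it is `α`-`ℓ`-normal for every positive `ℓ`. -/
def IsNormal {A : Type*} (α : A → ℝ) (S : ℕ → A) : Prop :=
  ∀ ℓ : ℕ, 0 < ℓ → IsBlockNormal α ℓ S

/-- The function `α` is a positive probability measure on the finite set `A`. -/
def IsPosProb {A : Type*} [Fintype A] (α : A → ℝ) : Prop :=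
  (∀ a, 0 < α a) ∧ ∑ a, α a = 1

/-- The product probability measure on pairs. -/
def prodProb {A : Type*} (α β : A → ℝ) : A × A → ℝ := fun p => α p.1 * β p.2

/-- The paired sequence. -/
def pairSeq {A : Type*} (S T : ℕ → A) : ℕ → A × A := fun i => (S i, T i)

end Normality

section WellDefined

/-! The minima and the limits in the definitions above exist. -/

variable {A : Type*}

/-- Add unreachable states. -/
def FSC.extend {r s : ℕ} (h : r ≤ s) (C : FSC A r) : FSC A s where
  step q a := if hq : q.1 < r then Fin.castLE h (C.step ⟨q.1, hq⟩ a) else q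
  out q a := if hq : q.1 < r then C.out ⟨q.1, hq⟩ a else []
  start := Fin.castLE h C.start

theorem FSC.extend_outputFrom {r s : ℕ} (h : r ≤ s) (C : FSC A r) (u : List A) (q : Fin r) :
    (C.extend h).outputFrom (Fin.castLE h q) u = C.outputFrom q u := by
  induction u generalizing q with
  | nil => rfl
  | cons a u ih =>
    have h1 : (C.extend h).step (Fin.castLE h q) a = Fin.castLE h (C.step q a) := by
      simp [FSC.extend]
    have h2 : (C.extend h).out (Fin.castLE h q) a = C.out q a := by
      simp [FSC.extend]
    simp only [FSC.outputFrom, h1, h2, ih]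

theorem FSC.extend_stateFrom {r s : ℕ} (h : r ≤ s) (C : FSC A r) (u : List A) (q : Fin r) :
    (C.extend h).stateFrom (Fin.castLE h q) u = Fin.castLE h (C.stateFrom q u) := by
  induction u generalizing q with
  | nil => rfl
  | cons a u ih =>
    have h1 : (C.extend h).step (Fin.castLE h q) a = Fin.castLE h (C.step q a) := by
      simp [FSC.extend]
    simp only [FSC.stateFrom, h1, ih]

theorem FSC.extend_output {r s : ℕ} (h : r ≤ s) (C : FSC A r) (u : List A) :
    (C.extend h).output u = C.output u := C.extend_outputFrom h u C.start

theorem FSC.extend_isLossless {r s : ℕ} (h : r ≤ s) {C : FSC A r} (hC : C.IsLossless) :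
    (C.extend h).IsLossless := by
  intro u w huw
  apply hC
  simp only [Prod.mk.injEq, FSC.extend_output] at huw ⊢
  refine ⟨huw.1, ?_⟩
  have h2 : Fin.castLE h (C.finalState u) = Fin.castLE h (C.finalState w) := by
    have e1 : ∀ v, (C.extend h).finalState v = Fin.castLE h (C.finalState v) :=
      fun v => C.extend_stateFrom h v C.start
    rw [← e1, ← e1]; exact huw.2
  exact Fin.castLE_injective h h2

variable [Fintype A]

/-- There is a one-state lossless compressor whose output has length linear in the input. -/
theorem exists_block_code (A : Type*) [Fintype A] :
    ∃ C : FSC A 1, C.IsLossless ∧ ∀ u, (C.output u).length = (Fintype.card A + 1) * u.length := by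
  classical
  let e := Fintype.equivFin A
  let code : A → List Bool := fun a =>
    true :: List.ofFn fun i : Fin (Fintype.card A) => decide (e a = i)
  have hlen : ∀ a, (code a).length = Fintype.card A + 1 := by intro a; simp [code]
  have hinj : Function.Injective code := by
    intro a b hab
    simp only [code, List.cons.injEq, true_and] at hab
    have h1 := congrFun (List.ofFn_injective hab) (e a)
    simp at h1
    exact h1.symm
  let C : FSC A 1 := ⟨fun q _ => q, fun _ a => code a, 0⟩
  have hout : ∀ q u, (C.outputFrom q u).length = (Fintype.card A + 1) * u.length := by
    intro q u
    induction u generalizing q with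
    | nil => rfl
    | cons a u ih =>
      simp only [FSC.outputFrom, List.length_append, ih, List.length_cons]
      rw [show C.out q a = code a from rfl, hlen]; ring
  refine ⟨C, ?_, fun u => hout _ u⟩
  have key : ∀ q u w, C.outputFrom q u = C.outputFrom q w → u = w := by
    intro q u
    induction u generalizing q with
    | nil =>
      intro w h
      have h1 := congrArg List.length h
      rw [hout, hout] at h1
      have : w.length = 0 := by simpa using h1.symm
      exact (List.length_eq_zero_iff.mp this).symm
    | cons a u ih =>
      intro w h
      cases w with
      | nil =>
        have h1 := congrArg List.length h
        rw [hout, hout] at h1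
        simp at h1
      | cons b w =>
        have h2 : code a ++ C.outputFrom q u = code b ++ C.outputFrom q w := h
        obtain ⟨h3, h4⟩ := List.append_inj h2 (by rw [hlen, hlen])
        rw [hinj h3, ih q w h4]
  intro u w h
  exact key _ u w (Prod.mk.inj h).1

/-- For `r ≥ 1` the infimum over `r`-state lossless compressors of (output length)/`c` is a
minimum. -/
theorem isLeast_sInf_length {r : ℕ} (hr : 1 ≤ r) (u : List A) {c : ℝ} (hc : 0 ≤ c) :
    IsLeast {x : ℝ | ∃ C : FSC A r, C.IsLossless ∧ x = ((C.output u).length : ℝ) / c}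
      (sInf {x : ℝ | ∃ C : FSC A r, C.IsLossless ∧ x = ((C.output u).length : ℝ) / c}) := by
  set N : Set ℕ := {m | ∃ C : FSC A r, C.IsLossless ∧ m = (C.output u).length} with hN
  have hne : N.Nonempty := by
    obtain ⟨C, hC, -⟩ := exists_block_code A
    exact ⟨_, C.extend hr, FSC.extend_isLossless hr hC, rfl⟩
  obtain ⟨C, hC, hm⟩ := Nat.sInf_mem hne
  have hl : IsLeast {x : ℝ | ∃ C : FSC A r, C.IsLossless ∧ x = ((C.output u).length : ℝ) / c}
      ((sInf N : ℕ) / c : ℝ) := by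
    refine ⟨⟨C, hC, by rw [← hm]⟩, ?_⟩
    rintro x ⟨D, hD, rfl⟩
    have : sInf N ≤ (D.output u).length := Nat.sInf_le ⟨D, hD, rfl⟩
    gcongr
  rwa [hl.csInf_eq]

theorem normalizer_nonneg (n : ℕ) : 0 ≤ normalizer A n := by
  unfold normalizer
  have : 0 ≤ Real.logb 2 (Fintype.card A) := by
    unfold Real.logb
    exact div_nonneg (Real.log_natCast_nonneg _) (Real.log_nonneg (by norm_num))
  positivity

/-- The minimum defining the `r`-state compression ratio is attained. -/
theorem isLeast_rho {r : ℕ} (hr : 1 ≤ r) (u : List A) :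
    IsLeast {x : ℝ | ∃ C : FSC A r, C.IsLossless ∧ x = ratio C u} (rho r u) :=
  isLeast_sInf_length hr u (normalizer_nonneg u.length)

/-- The minimum defining the `r`-state joint compression ratio is attained. -/
theorem isLeast_jointRho {r : ℕ} (hr : 1 ≤ r) (u w : List A) :
    IsLeast {x : ℝ | ∃ C : FSC (A × A) r, C.IsLossless ∧ x = jointRatio C u w}
      (jointRho r u w) :=
  isLeast_sInf_length hr (u.zip w) (normalizer_nonneg u.length)

theorem rho_anti {r s : ℕ} (hr : 1 ≤ r) (h : r ≤ s) (u : List A) : rho s u ≤ rho r u := by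
  obtain ⟨C, hC, hx⟩ := (isLeast_rho hr u).1
  refine (isLeast_rho (hr.trans h) u).2 ⟨C.extend h, FSC.extend_isLossless h hC, ?_⟩
  rw [hx, ratio, ratio, FSC.extend_output]

theorem jointRho_anti {r s : ℕ} (hr : 1 ≤ r) (h : r ≤ s) (u w : List A) :
    jointRho s u w ≤ jointRho r u w := by
  obtain ⟨C, hC, hx⟩ := (isLeast_jointRho hr u w).1
  refine (isLeast_jointRho (hr.trans h) u w).2 ⟨C.extend h, FSC.extend_isLossless h hC, ?_⟩
  rw [hx, jointRatio, jointRatio, FSC.extend_output]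

theorem rho_nonneg (r : ℕ) (u : List A) : 0 ≤ rho r u := by
  refine Real.sInf_nonneg ?_
  rintro x ⟨C, -, rfl⟩
  exact div_nonneg (Nat.cast_nonneg _) (normalizer_nonneg _)

theorem jointRho_nonneg (r : ℕ) (u w : List A) : 0 ≤ jointRho r u w := by
  refine Real.sInf_nonneg ?_
  rintro x ⟨C, -, rfl⟩
  exact div_nonneg (Nat.cast_nonneg _) (normalizer_nonneg _)

theorem linear_div_normalizer_le (a n : ℕ) :
    ((a * n : ℕ) : ℝ) / normalizer A n ≤ a / Real.logb 2 (Fintype.card A) := by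
  unfold normalizer
  rcases Nat.eq_zero_or_pos n with rfl | hn
  · simp only [mul_zero, Nat.cast_zero, zero_div]
    exact div_nonneg (Nat.cast_nonneg _)
      (by simpa [normalizer] using normalizer_nonneg (A := A) 1)
  · have : (n : ℝ) ≠ 0 := by positivity
    push_cast
    rw [mul_comm (a : ℝ), mul_div_mul_left _ _ this]

theorem exists_rho_le (A : Type*) [Fintype A] :
    ∃ B : ℝ, ∀ r : ℕ, 1 ≤ r → ∀ u : List A, rho r u ≤ B := by
  obtain ⟨C, hC, hl⟩ := exists_block_code A
  refine ⟨((Fintype.card A + 1 : ℕ) : ℝ) / Real.logb 2 (Fintype.card A),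
    fun r hr u => (rho_anti le_rfl hr u).trans
    (((isLeast_rho le_rfl u).2 ⟨C, hC, rfl⟩).trans ?_)⟩
  rw [ratio, hl]
  exact linear_div_normalizer_le _ _

theorem exists_jointRho_le (A : Type*) [Fintype A] :
    ∃ B : ℝ, ∀ r : ℕ, 1 ≤ r → ∀ u w : List A, u.length = w.length → jointRho r u w ≤ B := by
  obtain ⟨C, hC, hl⟩ := exists_block_code (A × A)
  refine ⟨((Fintype.card (A × A) + 1 : ℕ) : ℝ) / Real.logb 2 (Fintype.card A),
    fun r hr u w huw => (jointRho_anti le_rfl hr u w).trans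
    (((isLeast_jointRho le_rfl u w).2 ⟨C, hC, rfl⟩).trans ?_)⟩
  rw [jointRatio, hl, List.length_zip, ← huw, min_self]
  exact linear_div_normalizer_le _ _

theorem exists_abs_mutualRho_le (A : Type*) [Fintype A] :
    ∃ B : ℝ, ∀ r t : ℕ, 1 ≤ r → 1 ≤ t → ∀ (S T : ℕ → A) (n : ℕ),
      -B ≤ mutualRho r t (pre S n) (pre T n) ∧ mutualRho r t (pre S n) (pre T n) ≤ B := by
  obtain ⟨B, hB⟩ := exists_rho_le A
  obtain ⟨B', hB'⟩ := exists_jointRho_le A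
  refine ⟨max (2 * B) B', fun r t hr ht S T n => ?_⟩
  have h1 := hB t ht (pre S n)
  have h2 := hB t ht (pre T n)
  have h3 := hB' r hr (pre S n) (pre T n) (by simp [pre])
  have h4 := rho_nonneg t (pre S n)
  have h5 := rho_nonneg t (pre T n)
  have h6 := jointRho_nonneg r (pre S n) (pre T n)
  have h7 := le_max_left (2 * B) B'
  have h8 := le_max_right (2 * B) B'
  unfold mutualRho
  constructor <;> linarith

/-- Uniform bounds for the real `limsup`, so that it is a genuine upper limit. -/
theorem exists_abs_upperMutualRho_le (A : Type*) [Fintype A] :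
    ∃ B : ℝ, ∀ r t : ℕ, 1 ≤ r → 1 ≤ t → ∀ S T : ℕ → A,
      -B ≤ upperMutualRho r t S T ∧ upperMutualRho r t S T ≤ B := by
  obtain ⟨B, hB⟩ := exists_abs_mutualRho_le A
  refine ⟨B, fun r t hr ht S T => ⟨?_, ?_⟩⟩
  · exact le_limsup_of_frequently_le
      (Frequently.of_forall fun n => (hB r t hr ht S T n).1)
      (isBoundedUnder_of ⟨B, fun n => (hB r t hr ht S T n).2⟩)
  · exact limsup_le_of_le
      (isBoundedUnder_of ⟨-B, fun n => (hB r t hr ht S T n).1⟩).isCoboundedUnder_le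
      (Eventually.of_forall fun n => (hB r t hr ht S T n).2)

theorem upperMutualRho_mono {r r' t t' : ℕ} (hr : 1 ≤ r) (ht : 1 ≤ t) (hrr : r ≤ r')
    (htt : t ≤ t') (S T : ℕ → A) : upperMutualRho r t' S T ≤ upperMutualRho r' t S T := by
  obtain ⟨B, hB⟩ := exists_abs_mutualRho_le A
  refine limsup_le_limsup (Eventually.of_forall fun n => ?_)
    (isBoundedUnder_of ⟨-B, fun n =>
      (hB r t' hr (ht.trans htt) S T n).1⟩).isCoboundedUnder_le
    (isBoundedUnder_of ⟨B, fun n => (hB r' t (hr.trans hrr) ht S T n).2⟩)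
  have h1 := rho_anti ht htt (pre S n)
  have h2 := rho_anti ht htt (pre T n)
  have h3 := jointRho_anti hr hrr (pre S n) (pre T n)
  simp only [mutualRho]
  linarith

/-- The inner limit exists. -/
theorem tendsto_innerUpper (S T : ℕ → A) {r : ℕ} (hr : 1 ≤ r) :
    Tendsto (fun t => upperMutualRho r t S T) atTop (𝓝 (innerUpper S T r)) := by
  obtain ⟨B, hB⟩ := exists_abs_upperMutualRho_le A
  apply tendsto_nhds_limUnder
  have hanti : Antitone fun t => upperMutualRho r (t + 1) S T := fun t t' h =>
    upperMutualRho_mono hr (by omega) le_rfl (by omega) S T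
  have h := tendsto_atTop_ciInf hanti ⟨-B, by
    rintro x ⟨t, rfl⟩; exact (hB r (t + 1) hr (by omega) S T).1⟩
  exact ⟨_, (tendsto_add_atTop_iff_nat 1).mp h⟩

/-- The outer limit exists. -/
theorem tendsto_upperMutualDim (S T : ℕ → A) :
    Tendsto (innerUpper S T) atTop (𝓝 (upperMutualDim S T)) := by
  obtain ⟨B, hB⟩ := exists_abs_upperMutualRho_le A
  apply tendsto_nhds_limUnder
  have hmono : Monotone fun r => innerUpper S T (r + 1) := fun r r' h =>
    le_of_tendsto_of_tendsto (tendsto_innerUpper S T (by omega))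
      (tendsto_innerUpper S T (by omega))
      ((eventually_ge_atTop 1).mono fun t ht =>
        upperMutualRho_mono (by omega) ht (by omega) le_rfl S T)
  have h := tendsto_atTop_ciSup hmono ⟨B, by
    rintro x ⟨r, rfl⟩
    exact le_of_tendsto (tendsto_innerUpper S T (by omega))
      ((eventually_ge_atTop 1).mono fun t ht => (hB (r + 1) t (by omega) ht S T).2)⟩
  exact ⟨_, (tendsto_add_atTop_iff_nat 1).mp h⟩

end WellDefined

end FSMutual

end

/-! Output lengths are compared with the ideal code length `info α S n`, the sum of -log α(S[i])
over i < n. If S is α-normal, an r-state lossless compressor beats it by at most εn for large n,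
uniformly over the compressors (`IsNormal.eventually_info_le`). This comes from a Kraft-type
inequality whose bound does not depend on the block length.

In the other direction, for every positive measure q on blocks one fixed compressor stays, up to a
constant, at most εn above the ideal length for q (`exists_lossless_le`). Taking q from α itself
attains `info`. If S is not α-normal, some block frequency is infinitely often away from its
probability, and tilting the measure at that block gains a positive relative entropy per block
(`exists_lossless_le_of_not_isNormal`).

Ideal lengths for a product measure add (`info_pairSeq`), so the mutual ratio measures how far the
pair compresses below the ideal length for α₁ × α₂. In the limit this is nonnegative, it is zero
when the pair is normal, and otherwise it exceeds a positive constant infinitely often, which a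
limsup detects. -/

namespace FSMutual

/-! ### Kraft-type inequality for lossless compressors. -/

namespace FSC

variable {A : Type*} {r : ℕ}

theorem stateFrom_append (C : FSC A r) (q : Fin r) (u v : List A) :
    C.stateFrom q (u ++ v) = C.stateFrom (C.stateFrom q u) v := by
  induction u generalizing q with
  | nil => rfl
  | cons a u ih => exact ih _

theorem outputFrom_append (C : FSC A r) (q : Fin r) (u v : List A) :
    C.outputFrom q (u ++ v) = C.outputFrom q u ++ C.outputFrom (C.stateFrom q u) v := by
  induction u generalizing q with
  | nil => rfl
  | cons a u ih =>
    simp only [List.cons_append, outputFrom, ih, List.append_assoc, stateFrom]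

/-- A state is reachable if some input leads to it from the initial state. -/
def Reachable (C : FSC A r) (q : Fin r) : Prop := ∃ u, C.finalState u = q

/-- Prepending an input that leads to q reduces the claim to losslessness from the initial state; an
unreachable state carries no such guarantee. -/
theorem IsLossless.injective_from {C : FSC A r} (hC : C.IsLossless) {q : Fin r}
    (hq : C.Reachable q) :
    Function.Injective fun x : List A => (C.outputFrom q x, C.stateFrom q x) := by
  obtain ⟨u, rfl⟩ := hq
  intro x y hxy
  obtain ⟨h1, h2⟩ := Prod.mk.inj hxy
  have : u ++ x = u ++ y := by
    apply hC
    simp only [output, finalState, outputFrom_append, stateFrom_append] at h1 h2 ⊢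
    rw [h1, h2]
  exact List.append_cancel_left this

end FSC

/-- At most 2^j words have length j, so a geometric series dominates. The words need not form a
prefix code, hence θ < 1/2 strictly. -/
theorem sum_pow_length_le {θ : ℝ} (h0 : 0 ≤ θ) (h1 : 2 * θ < 1) (F : Finset (List Bool)) :
    ∑ w ∈ F, θ ^ w.length ≤ (1 - 2 * θ)⁻¹ := by
  classical
  set M := F.sup List.length + 1
  have hM : ∀ w ∈ F, w.length ∈ Finset.range M := fun w hw =>
    Finset.mem_range.2 (Nat.lt_succ_of_le (Finset.le_sup (f := List.length) hw))
  rw [← Finset.sum_fiberwise_of_maps_to hM, ← tsum_geometric_of_lt_one (by positivity) h1]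
  refine le_trans (Finset.sum_le_sum fun j _ => ?_)
    ((summable_geometric_of_lt_one (by positivity) h1).sum_le_tsum (Finset.range M)
      fun _ _ => by positivity)
  have hcard : (F.filter fun w => w.length = j).card ≤ 2 ^ j := by
    have h2 : Fintype.card (List.Vector Bool j) = 2 ^ j := by simp
    rw [← h2, ← Fintype.card_coe]
    refine Fintype.card_le_of_injective
      (fun w => ⟨w.1, (Finset.mem_filter.1 w.2).2⟩) fun a b hab => ?_
    have h3 := congrArg Subtype.val hab
    exact Subtype.ext h3
  calc ∑ w ∈ F with w.length = j, θ ^ w.length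
      = ∑ w ∈ F with w.length = j, θ ^ j :=
        Finset.sum_congr rfl fun w hw => by rw [(Finset.mem_filter.1 hw).2]
    _ = ((F.filter fun w => w.length = j).card : ℝ) * θ ^ j := by simp
    _ ≤ (2 : ℝ) ^ j * θ ^ j := by
        gcongr
        exact_mod_cast hcard
    _ = (2 * θ) ^ j := (mul_pow _ _ _).symm

/-- Among inputs that end in the same state the output is injective; summing over the r end states
gives the factor r. The bound is independent of X, so long blocks cost nothing extra. -/
theorem FSC.IsLossless.sum_pow_length_le {A X : Type*} [Fintype X] {r : ℕ} {C : FSC A r}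
    (hC : C.IsLossless) {q : Fin r} (hq : C.Reachable q) {f : X → List A}
    (hf : Function.Injective f) {θ : ℝ} (h0 : 0 ≤ θ) (h1 : 2 * θ < 1) :
    ∑ x, θ ^ (C.outputFrom q (f x)).length ≤ r * (1 - 2 * θ)⁻¹ := by
  classical
  rw [← Finset.sum_fiberwise (s := Finset.univ) (g := fun x => C.stateFrom q (f x))]
  have : ∀ s : Fin r, ∑ x with C.stateFrom q (f x) = s, θ ^ (C.outputFrom q (f x)).length
      ≤ (1 - 2 * θ)⁻¹ := by
    intro s
    have hinj : Set.InjOn (fun x => C.outputFrom q (f x))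
        (Finset.univ.filter fun x => C.stateFrom q (f x) = s : Finset X) := by
      intro x hx y hy hxy
      simp only [Finset.coe_filter, Finset.mem_univ, true_and, Set.mem_ofPred_eq] at hx hy
      exact hf (hC.injective_from hq (Prod.ext hxy (hx.trans hy.symm)))
    rw [← Finset.sum_image (f := fun w : List Bool => θ ^ w.length) hinj]
    exact FSMutual.sum_pow_length_le h0 h1 _
  refine (Finset.sum_le_sum fun s _ => this s).trans ?_
  simp

/-! ### Block decomposition and ideal code length. -/

section Blocks

variable {A : Type*}

theorem length_pre (S : ℕ → A) (n : ℕ) : (pre S n).length = n := by simp [pre]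

theorem pre_add (S : ℕ → A) (n m : ℕ) :
    pre S (n + m) = pre S n ++ pre (fun i => S (n + i)) m := by
  simp [pre, List.range_add, Function.comp_def]

/-- The `j`-th aligned block of length `ℓ` of a sequence. -/
def block (S : ℕ → A) (ℓ j : ℕ) : Fin ℓ → A := fun i => S (j * ℓ + i)

theorem pre_eq_ofFn_block (S : ℕ → A) (ℓ j : ℕ) :
    pre (fun i => S (j * ℓ + i)) ℓ = List.ofFn (block S ℓ j) := by
  apply List.ext_getElem <;> simp [pre, block]

theorem pre_succ_mul (S : ℕ → A) (n ℓ : ℕ) :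
    pre S ((n + 1) * ℓ) = pre S (n * ℓ) ++ List.ofFn (block S ℓ n) := by
  rw [Nat.succ_mul, pre_add, pre_eq_ofFn_block]

theorem length_output_pre_mul {r : ℕ} (C : FSC A r) (S : ℕ → A) (n ℓ : ℕ) :
    (C.output (pre S (n * ℓ))).length = ∑ j ∈ Finset.range n,
      (C.outputFrom (C.finalState (pre S (j * ℓ))) (List.ofFn (block S ℓ j))).length := by
  induction n with
  | zero => simp [pre, FSC.output, FSC.outputFrom]
  | succ n ih =>
    rw [Finset.sum_range_succ, ← ih, pre_succ_mul, FSC.output, FSC.outputFrom_append,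
      List.length_append]
    rfl

theorem length_output_pre_mono {r : ℕ} (C : FSC A r) (S : ℕ → A) {n m : ℕ} (h : n ≤ m) :
    (C.output (pre S n)).length ≤ (C.output (pre S m)).length := by
  obtain ⟨k, rfl⟩ := Nat.exists_eq_add_of_le h
  rw [pre_add, FSC.output, FSC.output, FSC.outputFrom_append, List.length_append]
  exact Nat.le_add_right _ _

/-- Grouping indices by the block found there turns a sum along the sequence into an empirical
expectation. -/
theorem sum_block_eq [Fintype A] {ℓ : ℕ} (S : ℕ → A) (n : ℕ) (f : (Fin ℓ → A) → ℝ) :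
    ∑ j ∈ Finset.range n, f (block S ℓ j) = n * ∑ x, blockFreq S n x * f x := by
  classical
  rcases Nat.eq_zero_or_pos n with rfl | hn
  · simp
  rw [← Finset.sum_fiberwise (s := Finset.range n) (g := fun j => block S ℓ j), Finset.mul_sum]
  refine Finset.sum_congr rfl fun x _ => ?_
  have h1 : {m : ℕ | m < n ∧ ∀ i : Fin ℓ, S (m * ℓ + i) = x i}
      = ((Finset.range n).filter fun j => block S ℓ j = x : Finset ℕ) := by
    ext m; simp [block, funext_iff]
  rw [blockFreq, h1, Set.ncard_coe_finset]
  have h2 : (n : ℝ) ≠ 0 := by positivity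
  calc ∑ j ∈ Finset.range n with block S ℓ j = x, f (block S ℓ j)
      = ∑ j ∈ Finset.range n with block S ℓ j = x, f x :=
        Finset.sum_congr rfl fun j hj => by rw [(Finset.mem_filter.1 hj).2]
    _ = _ := by
        rw [Finset.sum_const, nsmul_eq_mul]
        field_simp

/-- The ideal code length of the first `n` symbols of `S` with respect to the measure `α`. -/
noncomputable def info (α : A → ℝ) (S : ℕ → A) (n : ℕ) : ℝ :=
  ∑ i ∈ Finset.range n, -Real.logb 2 (α (S i))

theorem sum_logb_prod_block {α : A → ℝ} (hα : ∀ a, 0 < α a) (S : ℕ → A) (n ℓ : ℕ) :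
    ∑ j ∈ Finset.range n, -Real.logb 2 (∏ i, α (block S ℓ j i)) = info α S (n * ℓ) := by
  induction n with
  | zero => simp [info]
  | succ n ih =>
    rw [Finset.sum_range_succ, ih, Nat.succ_mul, info, info, Finset.sum_range_add,
      Real.logb_prod _ _ fun i _ => (hα _).ne', ← Finset.sum_neg_distrib]
    congr 1
    exact Fin.sum_univ_eq_sum_range (fun i => -Real.logb 2 (α (S (n * ℓ + i)))) ℓ

/-- The ideal code lengths of single symbols are bounded. -/
theorem exists_neg_logb_le [Fintype A] (α : A → ℝ) :
    ∃ G : ℝ, 0 < G ∧ ∀ a, -Real.logb 2 (α a) ≤ G := by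
  refine ⟨∑ a, |Real.logb 2 (α a)| + 1, by positivity, fun a => ?_⟩
  have := Finset.single_le_sum (f := fun a => |Real.logb 2 (α a)|) (fun b _ => abs_nonneg _)
    (Finset.mem_univ a)
  have h2 := neg_le_abs (Real.logb 2 (α a))
  linarith

theorem info_add_le {α : A → ℝ} {G : ℝ} (hG : ∀ a, -Real.logb 2 (α a) ≤ G) (S : ℕ → A)
    (n m : ℕ) : info α S (n + m) ≤ info α S n + m * G := by
  rw [info, info, Finset.sum_range_add]
  gcongr
  refine (Finset.sum_le_sum fun i _ => hG _).trans ?_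
  simp

end Blocks

/-! ### Normal sequences cannot be compressed below the ideal length. -/

section LowerBound

variable {A : Type*} [Fintype A]

/-- If the frequencies of blocks of length `ℓ` are at most twice the probabilities given by `α`,
then the output of a lossless compressor is not much shorter than the ideal code length. -/
theorem info_le_length_output {α : A → ℝ} (hα : IsPosProb α) {S : ℕ → A} {ℓ n r : ℕ}
    (hfreq : ∀ x : Fin ℓ → A, blockFreq S n x ≤ 2 * ∏ i, α (x i)) {C : FSC A r}
    (hC : C.IsLossless) {η : ℝ} (hη : 0 < η) :
    info α S (n * ℓ) ≤ (1 + η) * (C.output (pre S (n * ℓ))).length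
      + n * Real.logb 2 (2 * (r * (r * (1 - 2 * (2 : ℝ) ^ (-(1 + η)))⁻¹))) := by
  classical
  -- Slightly below 1/2, so the Kraft-type sum converges; the price is the factor 1 + η on the
  -- output length.
  set θ : ℝ := (2 : ℝ) ^ (-(1 + η)) with hθ
  have hθ0 : 0 < θ := by positivity
  have hθ1 : 2 * θ < 1 := by
    have : 2 * θ = (2 : ℝ) ^ (-η) := by
      rw [hθ, neg_add, Real.rpow_add (by norm_num), Real.rpow_neg_one]; ring
    rw [this]
    exact Real.rpow_lt_one_of_one_lt_of_neg (by norm_num) (by linarith)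
  have hr : 0 < r := C.start.pos
  set Z : ℝ := r * (r * (1 - 2 * θ)⁻¹) with hZ
  have hZ0 : 0 < Z := by
    have h1 : 0 < 1 - 2 * θ := by linarith
    positivity
  let R : Finset (Fin r) := Finset.univ.filter C.Reachable
  -- Summing over reachable states removes the dependence on the state in which the block is
  -- entered.
  let w : (Fin ℓ → A) → ℝ := fun x => ∑ q ∈ R, θ ^ (C.outputFrom q (List.ofFn x)).length
  have hstart : ∀ u, C.finalState u ∈ R := fun u =>
    Finset.mem_filter.2 ⟨Finset.mem_univ _, u, rfl⟩
  have hw0 : ∀ x, 0 < w x := fun x =>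
    Finset.sum_pos (fun _ _ => by positivity) ⟨_, hstart []⟩
  have hwsum : ∑ x, w x ≤ Z := by
    rw [Finset.sum_comm]
    refine (Finset.sum_le_sum fun q hq => hC.sum_pow_length_le (Finset.mem_filter.1 hq).2
      List.ofFn_injective hθ0.le hθ1).trans ?_
    rw [Finset.sum_const, nsmul_eq_mul, hZ]
    have h1 : 0 < 1 - 2 * θ := by linarith
    have h2 : R.card ≤ r := (Finset.card_le_univ R).trans (by simp)
    gcongr
  let P : (Fin ℓ → A) → ℝ := fun x => ∏ i, α (x i)
  have hP0 : ∀ x, 0 < P x := fun x => Finset.prod_pos fun i _ => hα.1 _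
  have hlog2 : 0 < Real.log 2 := Real.log_pos (by norm_num)
  -- This is log z ≤ z - 1 at z = w/(2ZP); by the frequency bound the average of z over the blocks
  -- is at most 1, which cancels the -1.
  have hpt : ∀ j, -Real.logb 2 (P (block S ℓ j)) ≤
      (1 + η) * (C.outputFrom (C.finalState (pre S (j * ℓ)))
        (List.ofFn (block S ℓ j))).length
      + (Real.log (2 * Z) - 1 + w (block S ℓ j) / P (block S ℓ j) / (2 * Z)) / Real.log 2 := by
    intro j
    set x := block S ℓ j
    set len := (C.outputFrom (C.finalState (pre S (j * ℓ))) (List.ofFn x)).length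
    have h1 : θ ^ len ≤ w x :=
      Finset.single_le_sum (f := fun q => θ ^ (C.outputFrom q (List.ofFn x)).length)
        (fun _ _ => by positivity) (hstart _)
    have h2 : -((1 + η) * len) * Real.log 2 ≤ Real.log (w x) := by
      have h3 := Real.log_le_log (by positivity) h1
      rw [Real.log_pow, hθ, Real.log_rpow (by norm_num)] at h3
      linarith
    have h3 : Real.log (w x / P x / (2 * Z)) ≤ w x / P x / (2 * Z) - 1 :=
      Real.log_le_sub_one_of_pos (by have := hw0 x; have := hP0 x; positivity)
    rw [Real.log_div (div_pos (hw0 x) (hP0 x)).ne' (by positivity),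
      Real.log_div (hw0 x).ne' (hP0 x).ne'] at h3
    rw [Real.logb, ← neg_div, div_le_iff₀ hlog2, add_mul,
      div_mul_cancel₀ _ hlog2.ne']
    linarith
  have hsum : ∑ j ∈ Finset.range n, w (block S ℓ j) / P (block S ℓ j) ≤ n * (2 * Z) := by
    rw [sum_block_eq S n fun x => w x / P x]
    gcongr
    calc ∑ x, blockFreq S n x * (w x / P x) ≤ ∑ x, 2 * P x * (w x / P x) :=
          Finset.sum_le_sum fun x _ => mul_le_mul_of_nonneg_right (hfreq x)
            (div_pos (hw0 x) (hP0 x)).le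
      _ = 2 * ∑ x, w x := by
          rw [Finset.mul_sum]
          refine Finset.sum_congr rfl fun x _ => ?_
          have := (hP0 x).ne'
          field_simp
      _ ≤ 2 * Z := by gcongr
  rw [← sum_logb_prod_block hα.1, length_output_pre_mul]
  refine (Finset.sum_le_sum fun j _ => hpt j).trans ?_
  rw [Finset.sum_add_distrib, ← Finset.sum_div, Finset.sum_add_distrib, ← Finset.sum_div,
    Finset.sum_const, Finset.card_range, nsmul_eq_mul, Nat.cast_sum, Finset.mul_sum, Real.logb,
    ← mul_div_assoc]
  gcongr
  have h4 : (∑ j ∈ Finset.range n, w (block S ℓ j) / P (block S ℓ j)) / (2 * Z) ≤ n := by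
    rw [div_le_iff₀ (by positivity)]; exact hsum
  linarith

/-- The output of an `r`-state lossless compressor on a prefix of an `α`-normal sequence is
asymptotically at least the ideal code length, uniformly over the compressors. -/
theorem IsNormal.eventually_info_le {α : A → ℝ} (hα : IsPosProb α) {S : ℕ → A}
    (hS : IsNormal α S) (r : ℕ) {ε : ℝ} (hε : 0 < ε) :
    ∀ᶠ n : ℕ in atTop, ∀ C : FSC A r, C.IsLossless →
      info α S n ≤ (C.output (pre S n)).length + ε * n := by
  obtain ⟨G, hG0, hG⟩ := exists_neg_logb_le α
  set η : ℝ := ε / (3 * G) with hη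
  have hη0 : 0 < η := by positivity
  set c := Real.logb 2 (2 * (r * (r * (1 - 2 * (2 : ℝ) ^ (-(1 + η)))⁻¹)))
  -- The loss c per block does not depend on the block length, so blocks of length L reduce it to at
  -- most ε/3 per symbol.
  obtain ⟨L, hL⟩ := exists_nat_gt (max 0 (c / (ε / 3)))
  have hL0 : 0 < L := by
    have := (le_max_left _ _).trans_lt hL
    exact_mod_cast this
  have hLc : c ≤ ε / 3 * L := by
    have := (le_max_right _ _).trans_lt hL
    rw [div_lt_iff₀ (by positivity)] at this
    linarith
  have hfr : ∀ᶠ n : ℕ in atTop, ∀ x : Fin L → A, blockFreq S n x ≤ 2 * ∏ i, α (x i) := by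
    rw [eventually_all]
    intro x
    have hP : 0 < ∏ i, α (x i) := Finset.prod_pos fun i _ => hα.1 _
    exact ((hS L hL0 x).eventually (gt_mem_nhds (by linarith))).mono fun _ h => h.le
  obtain ⟨K, hK⟩ := exists_nat_gt (3 * (L * G) / ε)
  filter_upwards [(Nat.tendsto_div_const_atTop hL0.ne').eventually hfr, eventually_ge_atTop K]
    with n hn hKn C hC
  have h1 := info_le_length_output hα hn hC hη0
  have hdm : n / L * L + n % L = n := Nat.div_add_mod' n L
  have h2 : info α S n ≤ info α S (n / L * L) + L * G := by
    have h3 := info_add_le hG S (n / L * L) (n % L)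
    rw [hdm] at h3
    have h4 : ((n % L : ℕ) : ℝ) ≤ L := by exact_mod_cast (Nat.mod_lt _ hL0).le
    nlinarith
  have h3 : ((C.output (pre S (n / L * L))).length : ℝ) ≤ (C.output (pre S n)).length := by
    exact_mod_cast length_output_pre_mono C S (Nat.div_mul_le_self n L)
  have h5 : ((n / L : ℕ) : ℝ) * c ≤ ε / 3 * n := by
    have h6 : ((n / L : ℕ) : ℝ) * L ≤ n := by exact_mod_cast Nat.div_mul_le_self n L
    calc ((n / L : ℕ) : ℝ) * c ≤ ((n / L : ℕ) : ℝ) * (ε / 3 * L) := by gcongr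
      _ = ε / 3 * (((n / L : ℕ) : ℝ) * L) := by ring
      _ ≤ _ := by gcongr
  have h7 : L * G ≤ ε / 3 * n := by
    have h8 : (K : ℝ) ≤ n := by exact_mod_cast hKn
    have h9 := hK.le.trans h8
    rw [div_le_iff₀ hε] at h9
    linarith
  set len : ℝ := ((C.output (pre S n)).length : ℝ)
  -- The term η * len is small only for outputs of at most G * n bits; a longer output already
  -- exceeds the trivial bound on `info`.
  by_cases hlen : len ≤ G * n
  · have h8 : η * len ≤ ε / 3 * n := by
      calc η * len ≤ η * (G * n) := by gcongr
        _ = ε / 3 * n := by rw [hη]; field_simp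
    have h9 : (1 + η) * ((C.output (pre S (n / L * L))).length : ℝ) ≤ (1 + η) * len := by gcongr
    linarith
  · have h8 := info_add_le hG S 0 n
    rw [zero_add] at h8
    have h9 : info α S 0 = 0 := by simp [info]
    have h10 : 0 ≤ ε * n := by positivity
    linarith [not_le.1 hlen]

end LowerBound

/-! ### Prefix codes and block compressors. -/

/-- A prefix code whose code lengths are close to `-log q`: the code word of `x` consists of the
unary representation of `j = ⌈-log q(x) / s⌉` and an index of `s * j` bits. -/
theorem exists_prefix_code {X : Type*} [Fintype X] {q : X → ℝ} (hq : ∀ x, 0 < q x)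
    (hsum : ∑ x, q x ≤ 1) {s : ℕ} (hs : 0 < s) :
    ∃ c : X → List Bool, (∀ x, c x ≠ []) ∧
      (∀ x y u v, c x ++ u = c y ++ v → x = y) ∧
      ∀ x, ((c x).length : ℝ) ≤ (1 + 1 / s) * -Real.logb 2 (q x) + (s + 2) := by
  classical
  let k : X → ℕ := fun x => ⌈-Real.logb 2 (q x) / s⌉₊
  have hs' : (0 : ℝ) < s := by exact_mod_cast hs
  have hq1 : ∀ x, q x ≤ 1 := fun x =>
    (Finset.single_le_sum (fun y _ => (hq y).le) (Finset.mem_univ x)).trans hsum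
  have hkq : ∀ x, ((2 : ℝ) ^ (s * k x))⁻¹ ≤ q x := by
    intro x
    have h1 : -Real.logb 2 (q x) ≤ (s * k x : ℕ) := by
      have := Nat.le_ceil (-Real.logb 2 (q x) / s)
      rw [div_le_iff₀ hs'] at this
      push_cast
      linarith
    rw [← Real.rpow_natCast, ← Real.rpow_neg (by norm_num),
      ← Real.le_logb_iff_rpow_le (by norm_num) (hq x)]
    linarith
  -- Each x with k x = j has mass at least 2^(-s * j), so s * j bits suffice to index them.
  have hcard : ∀ j, Fintype.card {x // k x = j} ≤ Fintype.card (Fin (s * j) → Bool) := by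
    intro j
    have h1 : (Fintype.card {x // k x = j} : ℝ) * ((2 : ℝ) ^ (s * j))⁻¹ ≤ 1 := by
      calc (Fintype.card {x // k x = j} : ℝ) * ((2 : ℝ) ^ (s * j))⁻¹
          = ∑ x with k x = j, ((2 : ℝ) ^ (s * j))⁻¹ := by
            rw [Finset.sum_const, nsmul_eq_mul, Fintype.card_subtype]
        _ ≤ ∑ x with k x = j, q x := Finset.sum_le_sum fun x hx => by
            rw [← (Finset.mem_filter.1 hx).2]; exact hkq x
        _ ≤ ∑ x, q x := Finset.sum_le_sum_of_subset_of_nonneg (Finset.filter_subset _ _)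
            fun x _ _ => (hq x).le
        _ ≤ 1 := hsum
    rw [← div_eq_mul_inv, div_le_one (by positivity)] at h1
    simp only [Fintype.card_fun, Fintype.card_bool, Fintype.card_fin]
    exact_mod_cast h1
  let e := fun j => Classical.choice (Function.Embedding.nonempty_of_card_le (hcard j))
  let c : X → List Bool := fun x =>
    List.replicate (k x) true ++ false :: List.ofFn (e (k x) ⟨x, rfl⟩)
  have hlen : ∀ x, (c x).length = k x + 1 + s * k x := by
    intro x
    simp [c]; ring
  have hunary : ∀ (i j : ℕ) (u v : List Bool), List.replicate i true ++ false :: u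
      = List.replicate j true ++ false :: v → i = j := by
    intro i
    induction i with
    | zero =>
      intro j u v h
      cases j with
      | zero => rfl
      | succ j => simp [List.replicate_succ] at h
    | succ i ih =>
      intro j u v h
      cases j with
      | zero => simp [List.replicate_succ] at h
      | succ j =>
        simp only [List.replicate_succ, List.cons_append, List.cons.injEq, true_and] at h
        rw [ih j u v h]
  refine ⟨c, fun x => by simp [c], fun x y u v h => ?_, fun x => ?_⟩
  · have hk : k x = k y := by
      simp only [c, List.append_assoc, List.cons_append] at h
      exact hunary _ _ _ _ h
    have hc : c x = c y := (List.append_inj h (by rw [hlen, hlen, hk])).1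
    -- A common variable j puts both indices in the same subtype, so injectivity of `e j` applies.
    have key : ∀ j (hx : k x = j) (hy : k y = j),
        List.replicate j true ++ false :: List.ofFn (e j ⟨x, hx⟩)
          = List.replicate j true ++ false :: List.ofFn (e j ⟨y, hy⟩) → x = y := by
      intro j hx hy h
      have h1 := (List.cons.inj (List.append_cancel_left h)).2
      exact congrArg Subtype.val ((e j).injective (List.ofFn_injective h1))
    refine key (k y) hk rfl ?_
    have gen : ∀ j (hx : k x = j), c x
        = List.replicate j true ++ false :: List.ofFn (e j ⟨x, hx⟩) := by
      rintro _ rfl; rfl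
    rw [← gen, hc]
  · have h0 : 0 ≤ -Real.logb 2 (q x) :=
      neg_nonneg.2 (Real.logb_nonpos (by norm_num) (hq x).le (hq1 x))
    have h1 : (k x : ℝ) ≤ -Real.logb 2 (q x) / s + 1 :=
      (Nat.ceil_lt_add_one (div_nonneg h0 hs'.le)).le
    rw [hlen]
    push_cast
    calc (k x : ℝ) + 1 + s * k x = (s + 1) * k x + 1 := by ring
      _ ≤ (s + 1) * (-Real.logb 2 (q x) / s + 1) + 1 := by gcongr
      _ = _ := by field_simp; ring

namespace FSC

variable {A : Type*} {r : ℕ}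

/-- The compressor that outputs the code word `c x` after each complete block `x` of length `N`.
Its states are the incomplete blocks. -/
def ofBlockCode {N : ℕ} (hN : 0 < N) (e : {l : List A // l.length < N} ≃ Fin r)
    (c : List A → List Bool) : FSC A r where
  step q a := e (if h : ((e.symm q).1 ++ [a]).length < N then ⟨(e.symm q).1 ++ [a], h⟩
    else ⟨[], hN⟩)
  out q a := if ((e.symm q).1 ++ [a]).length < N then [] else c ((e.symm q).1 ++ [a])
  start := e ⟨[], hN⟩

section

variable {N : ℕ} (hN : 0 < N) (e : {l : List A // l.length < N} ≃ Fin r)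
  (c : List A → List Bool)

theorem ofBlockCode_short (u : List A) (p : {l : List A // l.length < N})
    (h : (p.1 ++ u).length < N) :
    (ofBlockCode hN e c).stateFrom (e p) u = e ⟨p.1 ++ u, h⟩ ∧
      (ofBlockCode hN e c).outputFrom (e p) u = [] := by
  induction u generalizing p with
  | nil => simp [stateFrom, outputFrom]
  | cons a u ih =>
    have h1 : (p.1 ++ [a]).length < N := by simp at h ⊢; omega
    have h2 : (ofBlockCode hN e c).step (e p) a = e ⟨p.1 ++ [a], h1⟩ := by
      simp only [ofBlockCode, Equiv.symm_apply_apply, dif_pos h1]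
    have h3 : (ofBlockCode hN e c).out (e p) a = [] := by
      simp only [ofBlockCode, Equiv.symm_apply_apply, if_pos h1]
    have h4 := ih ⟨p.1 ++ [a], h1⟩ (by simpa using h)
    simp only [stateFrom, outputFrom, h2, h3, h4.1, h4.2, List.append_assoc, List.cons_append,
      List.nil_append, and_self]

theorem ofBlockCode_full (u : List A) (p : {l : List A // l.length < N})
    (h : (p.1 ++ u).length = N) :
    (ofBlockCode hN e c).stateFrom (e p) u = e ⟨[], hN⟩ ∧
      (ofBlockCode hN e c).outputFrom (e p) u = c (p.1 ++ u) := by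
  -- Only the last symbol of the block triggers output and the return to the empty buffer.
  obtain rfl | ⟨v, a, rfl⟩ := List.eq_nil_or_concat' u
  · have := p.2
    simp at h
    omega
  have h1 : (p.1 ++ v).length < N := by simp at h ⊢; omega
  have h2 : ¬ (p.1 ++ v ++ [a]).length < N := by simp at h ⊢; omega
  obtain ⟨h3, h4⟩ := ofBlockCode_short hN e c v p h1
  rw [stateFrom_append, outputFrom_append, h3, h4, ← List.append_assoc]
  simp only [stateFrom, outputFrom, ofBlockCode, Equiv.symm_apply_apply, dif_neg h2, if_neg h2,
    List.append_nil, List.nil_append, and_self]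

/-- The state and the output after the first complete block. -/
theorem ofBlockCode_cases (w : List A) (p : {l : List A // l.length < N}) :
    (∃ h : (p.1 ++ w).length < N, (ofBlockCode hN e c).stateFrom (e p) w = e ⟨p.1 ++ w, h⟩ ∧
      (ofBlockCode hN e c).outputFrom (e p) w = []) ∨
    ∃ w₁ w₂, w = w₁ ++ w₂ ∧ (p.1 ++ w₁).length = N ∧
      (ofBlockCode hN e c).stateFrom (e p) w
        = (ofBlockCode hN e c).stateFrom (e ⟨[], hN⟩) w₂ ∧
      (ofBlockCode hN e c).outputFrom (e p) w
        = c (p.1 ++ w₁) ++ (ofBlockCode hN e c).outputFrom (e ⟨[], hN⟩) w₂ := by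
  by_cases h : (p.1 ++ w).length < N
  · exact Or.inl ⟨h, ofBlockCode_short hN e c w p h⟩
  · have hp := p.2
    have h1 : (p.1 ++ w.take (N - p.1.length)).length = N := by
      simp at h ⊢; omega
    obtain ⟨h2, h3⟩ := ofBlockCode_full hN e c _ p h1
    refine Or.inr ⟨_, _, (List.take_append_drop (N - p.1.length) w).symm, h1, ?_, ?_⟩
    · conv_lhs => rw [← List.take_append_drop (N - p.1.length) w]
      rw [stateFrom_append, h2]
    · conv_lhs => rw [← List.take_append_drop (N - p.1.length) w]
      rw [outputFrom_append, h2, h3]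

variable {c}

/-- The prefix property decodes complete blocks one by one, nonempty code words reveal when the last
has been decoded, and the final state stores the incomplete remainder. -/
theorem ofBlockCode_isLossless (hc : ∀ x, c x ≠ [])
    (hpre : ∀ x y u v, x.length = N → y.length = N → c x ++ u = c y ++ v → x = y) :
    (ofBlockCode hN e c).IsLossless := by
  have key : ∀ (n : ℕ) (u w : List A), u.length ≤ n →
      (ofBlockCode hN e c).outputFrom (e ⟨[], hN⟩) u
        = (ofBlockCode hN e c).outputFrom (e ⟨[], hN⟩) w →
      (ofBlockCode hN e c).stateFrom (e ⟨[], hN⟩) u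
        = (ofBlockCode hN e c).stateFrom (e ⟨[], hN⟩) w → u = w := by
    intro n
    induction n with
    | zero =>
      intro u w hu ho hs
      obtain rfl : u = [] := List.length_eq_zero_iff.1 (by omega)
      rcases ofBlockCode_cases hN e c w ⟨[], hN⟩ with ⟨h1, h2, -⟩ | ⟨w₁, w₂, -, -, -, h1⟩
      · rw [h2] at hs
        simpa [stateFrom] using hs
      · rw [h1] at ho
        simp [outputFrom, hc] at ho
    | succ n ih =>
      intro u w hu ho hs
      rcases ofBlockCode_cases hN e c u ⟨[], hN⟩ with
          ⟨_, hu1, hu2⟩ | ⟨u₁, u₂, rfl, hul, hu1, hu2⟩ <;>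
        rcases ofBlockCode_cases hN e c w ⟨[], hN⟩ with
          ⟨_, hw1, hw2⟩ | ⟨w₁, w₂, rfl, hwl, hw1, hw2⟩ <;>
        rw [hu1, hw1] at hs <;> rw [hu2, hw2] at ho
      · simpa using hs
      · simp [hc] at ho
      · simp [hc] at ho
      · have h1 := hpre _ _ _ _ hul hwl ho
        simp only [List.nil_append] at h1 hul ho
        subst h1
        rw [ih u₂ w₂ (by simp at hu; omega) (List.append_cancel_left ho) hs]
  intro u w h
  obtain ⟨h1, h2⟩ := Prod.mk.inj h
  exact key _ u w le_rfl h1 h2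

theorem length_ofBlockCode_output (S : ℕ → A) (n : ℕ) :
    ((ofBlockCode hN e c).output (pre S (n * N))).length
      = ∑ j ∈ Finset.range n, (c (List.ofFn (block S N j))).length := by
  have hst : ∀ j, (ofBlockCode hN e c).finalState (pre S (j * N)) = e ⟨[], hN⟩ := by
    intro j
    induction j with
    | zero => simp [pre, finalState, stateFrom, ofBlockCode]
    | succ j ih =>
      rw [finalState] at ih
      rw [pre_succ_mul, finalState, stateFrom_append, ih]
      exact (ofBlockCode_full hN e c _ ⟨[], hN⟩ (by simp)).1
  rw [length_output_pre_mul]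
  refine Finset.sum_congr rfl fun j _ => ?_
  rw [hst, (ofBlockCode_full hN e c _ ⟨[], hN⟩ (by simp)).2]
  simp

end

end FSC

/-- For every measure `q` on blocks of length `ℓ` there is a lossless compressor whose output is
asymptotically at most the ideal code length with respect to `q`. -/
theorem exists_lossless_le {A : Type*} [Fintype A] [Nonempty A] {ℓ : ℕ} (hℓ : 0 < ℓ)
    {q : (Fin ℓ → A) → ℝ} (hq : IsPosProb q) {ε : ℝ} (hε : 0 < ε) :
    ∃ (r : ℕ) (C : FSC A r) (K : ℝ), C.IsLossless ∧ ∀ (S : ℕ → A) (n : ℕ),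
      ((C.output (pre S (n * ℓ))).length : ℝ)
        ≤ (∑ j ∈ Finset.range n, -Real.logb 2 (q (block S ℓ j))) + ε * n + K := by
  classical
  obtain ⟨G, hG0, hG⟩ := exists_neg_logb_le q
  -- Large s makes the relative overhead 1/s of the unary part cost at most ε/2 per block of length
  -- ℓ.
  obtain ⟨s, hs⟩ := exists_nat_gt (max 0 (2 * G / ε))
  have hs0 : 0 < s := by
    have := (le_max_left _ _).trans_lt hs
    exact_mod_cast this
  have hsG : 1 / s * G ≤ ε / 2 := by
    have := (le_max_right _ _).trans_lt hs
    rw [div_lt_iff₀ hε] at this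
    have h1 : (0 : ℝ) < s := by exact_mod_cast hs0
    rw [one_div, ← div_eq_inv_mul, div_le_iff₀ h1]
    linarith
  -- Each code word covers m blocks, so its additive overhead s + 2 costs at most ε/2 per block.
  obtain ⟨m, hm⟩ := exists_nat_gt (max 0 (2 * (s + 2) / ε))
  have hm0 : 0 < m := by
    have := (le_max_left _ _).trans_lt hm
    exact_mod_cast this
  have hms : (s + 2 : ℝ) ≤ ε / 2 * m := by
    have := (le_max_right _ _).trans_lt hm
    rw [div_lt_iff₀ hε] at this
    linarith
  have hsum : ∑ x : Fin m → Fin ℓ → A, ∏ i, q (x i) ≤ 1 := by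
    rw [← Fintype.prod_sum (fun (_ : Fin m) (y : Fin ℓ → A) => q y)]
    simp [hq.2]
  obtain ⟨c, hc0, hcpre, hclen⟩ := exists_prefix_code
    (fun x : Fin m → Fin ℓ → A => Finset.prod_pos fun i _ => hq.1 (x i)) hsum hs0
  have hN : 0 < m * ℓ := Nat.mul_pos hm0 hℓ
  have hfin : Finite {l : List A // l.length < m * ℓ} := List.finite_length_lt A (m * ℓ)
  obtain ⟨r, ⟨e⟩⟩ := hfin.exists_equiv_fin
  let a₀ : A := Classical.arbitrary A
  -- The default `a₀` is never read on lists of length m * ℓ.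
  let split : List A → Fin m → Fin ℓ → A := fun l j i => l.getD (j * ℓ + i) a₀
  let C : FSC A r := FSC.ofBlockCode hN e fun l => c (split l)
  have hsplit : ∀ S j i, split (List.ofFn (block S (m * ℓ) j)) i = block S ℓ (j * m + i) := by
    intro S j i
    funext k
    have h1 : (i : ℕ) * ℓ + k < m * ℓ := by
      have := Nat.mul_le_mul_right ℓ (Nat.succ_le_of_lt i.2)
      rw [Nat.succ_mul] at this
      omega
    simp only [split, block]
    rw [List.getD_eq_getElem _ _ (by simpa using h1)]
    simp only [List.getElem_ofFn, block]
    congr 1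
    ring
  refine ⟨r, C, m * G + 2 * ε * m, FSC.ofBlockCode_isLossless hN e (fun x => hc0 _) ?_, ?_⟩
  · intro x y u v hx hy h
    have h1 := hcpre _ _ _ _ h
    refine List.ext_getElem (hx.trans hy.symm) fun k hkx hky => ?_
    have hkm : k / ℓ < m := by
      rw [Nat.div_lt_iff_lt_mul hℓ]; omega
    have h2 := congrFun (congrFun h1 ⟨k / ℓ, hkm⟩) ⟨k % ℓ, Nat.mod_lt _ hℓ⟩
    simp only [split, Nat.div_add_mod'] at h2
    rwa [List.getD_eq_getElem _ _ hkx, List.getD_eq_getElem _ _ hky] at h2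
  · intro S n
    -- Rounding up makes the groups cover the prefix; the overshoot of at most m blocks goes into
    -- the constant.
    set n' := n / m + 1 with hn'
    set g : ℕ → ℝ := fun j => -Real.logb 2 (q (block S ℓ j)) with hg
    have hgG : ∀ j, g j ≤ G := fun j => hG _
    have hnn' : n ≤ n' * m := by
      have := Nat.lt_div_mul_add (a := n) hm0
      rw [hn', Nat.succ_mul]
      exact this.le
    have hn'n : n' * m ≤ n + m := by
      rw [hn', Nat.succ_mul]
      exact Nat.add_le_add_right (Nat.div_mul_le_self n m) m
    have h1 : (C.output (pre S (n * ℓ))).length ≤ (C.output (pre S (n' * (m * ℓ)))).length := by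
      apply length_output_pre_mono
      rw [← Nat.mul_assoc]
      exact Nat.mul_le_mul_right ℓ hnn'
    have h2 : ∀ j, ((c (split (List.ofFn (block S (m * ℓ) j)))).length : ℝ)
        ≤ (1 + 1 / s) * ∑ i ∈ Finset.range m, g (j * m + i) + (s + 2) := by
      intro j
      refine (hclen _).trans_eq ?_
      rw [Real.logb_prod _ _ fun i _ => (hq.1 _).ne', ← Finset.sum_neg_distrib,
        ← Fin.sum_univ_eq_sum_range (fun i => g (j * m + i))]
      simp only [hsplit, hg]
    have h3 : ∀ k, ∑ j ∈ Finset.range k, ∑ i ∈ Finset.range m, g (j * m + i)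
        = ∑ i ∈ Finset.range (k * m), g i := by
      intro k
      induction k with
      | zero => simp
      | succ k ih => rw [Finset.sum_range_succ, ih, Nat.succ_mul, Finset.sum_range_add]
    have h4 : ((C.output (pre S (n' * (m * ℓ)))).length : ℝ)
        ≤ (1 + 1 / s) * ∑ i ∈ Finset.range (n' * m), g i + n' * (s + 2) := by
      rw [FSC.length_ofBlockCode_output, Nat.cast_sum]
      refine (Finset.sum_le_sum fun j _ => h2 j).trans_eq ?_
      rw [Finset.sum_add_distrib, ← Finset.mul_sum, h3, Finset.sum_const, Finset.card_range,
        nsmul_eq_mul]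
    have h5 : ∑ i ∈ Finset.range (n' * m), g i ≤ ∑ i ∈ Finset.range n, g i + m * G := by
      obtain ⟨d, hd⟩ := Nat.exists_eq_add_of_le hnn'
      rw [hd, Finset.sum_range_add]
      gcongr
      refine (Finset.sum_le_sum fun i _ => hgG _).trans ?_
      have hdm : (d : ℝ) ≤ m := by exact_mod_cast (by omega : d ≤ m)
      simp only [Finset.sum_const, Finset.card_range, nsmul_eq_mul]
      gcongr
    have h6 : ((n' * m : ℕ) : ℝ) ≤ n + m := by exact_mod_cast hn'n
    have h7 : 1 / s * ∑ i ∈ Finset.range (n' * m), g i ≤ ε / 2 * (n + m) := by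
      have h8 : ∑ i ∈ Finset.range (n' * m), g i ≤ (n' * m : ℕ) * G :=
        (Finset.sum_le_sum fun i _ => hgG _).trans (by simp)
      calc 1 / s * ∑ i ∈ Finset.range (n' * m), g i ≤ 1 / s * ((n' * m : ℕ) * G) := by gcongr
        _ = (1 / s * G) * (n' * m : ℕ) := by ring
        _ ≤ ε / 2 * (n + m) := by gcongr
    have h8 : (n' : ℝ) * (s + 2) ≤ ε / 2 * (n + m) := by
      calc (n' : ℝ) * (s + 2) ≤ n' * (ε / 2 * m) := by gcongr
        _ = ε / 2 * (n' * m : ℕ) := by push_cast; ring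
        _ ≤ ε / 2 * (n + m) := by gcongr
    have h9 : ((C.output (pre S (n * ℓ))).length : ℝ)
        ≤ (C.output (pre S (n' * (m * ℓ)))).length := by exact_mod_cast h1
    have h10 : 0 ≤ ε * m := by positivity
    linarith

/-! ### Measures, frequencies and relative entropy. -/

section Probability

variable {A : Type*} [Fintype A]

theorem IsPosProb.prodProb {α β : A → ℝ} (hα : IsPosProb α) (hβ : IsPosProb β) :
    IsPosProb (prodProb α β) := by
  refine ⟨fun p => mul_pos (hα.1 _) (hβ.1 _), ?_⟩
  simp only [FSMutual.prodProb]
  rw [Fintype.sum_prod_type]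
  simp only [← Finset.mul_sum, hβ.2, mul_one, hα.2]

theorem IsPosProb.block {α : A → ℝ} (hα : IsPosProb α) (ℓ : ℕ) :
    IsPosProb fun x : Fin ℓ → A => ∏ i, α (x i) := by
  classical
  refine ⟨fun x => Finset.prod_pos fun i _ => hα.1 _, ?_⟩
  rw [← Fintype.prod_sum (fun (_ : Fin ℓ) (y : A) => α y)]
  simp [hα.2]

theorem IsPosProb.lt_one [Nontrivial A] {α : A → ℝ} (hα : IsPosProb α) (a : A) : α a < 1 := by
  obtain ⟨b, hb⟩ := exists_ne a
  rw [← hα.2]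
  exact Finset.single_lt_sum hb (Finset.mem_univ a) (Finset.mem_univ b) (hα.1 b)
    fun c _ _ => (hα.1 c).le

theorem blockFreq_nonneg {A : Type*} {ℓ : ℕ} (S : ℕ → A) (n : ℕ) (x : Fin ℓ → A) :
    0 ≤ blockFreq S n x := div_nonneg (Nat.cast_nonneg _) (Nat.cast_nonneg _)

theorem blockFreq_le_one {A : Type*} {ℓ : ℕ} (S : ℕ → A) (n : ℕ) (x : Fin ℓ → A) :
    blockFreq S n x ≤ 1 := by
  refine div_le_one_of_le₀ ?_ (Nat.cast_nonneg _)
  have h := Set.ncard_le_ncard (s := {m : ℕ | m < n ∧ ∀ i : Fin ℓ, S (m * ℓ + i) = x i})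
    (t := (Finset.range n : Set ℕ)) (fun m hm => by simpa using hm.1) (Finset.finite_toSet _)
  rw [Set.ncard_coe_finset, Finset.card_range] at h
  exact_mod_cast h

/-- Positivity of the relative entropy of two distinct Bernoulli measures. -/
theorem bernoulli_relEntropy_pos {p p' : ℝ} (hp : 0 < p) (hp1 : p < 1) (hp' : 0 < p')
    (hp1' : p' < 1) (hne : p' ≠ p) :
    0 < p' * Real.log (p' / p) + (1 - p') * Real.log ((1 - p') / (1 - p)) := by
  have h1 : Real.log (p / p') < p / p' - 1 :=
    Real.log_lt_sub_one_of_pos (by positivity) fun h => hne ((div_eq_one_iff_eq hp'.ne').1 h).symm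
  have h2 : Real.log ((1 - p) / (1 - p')) ≤ (1 - p) / (1 - p') - 1 :=
    Real.log_le_sub_one_of_pos (div_pos (by linarith) (by linarith))
  rw [← inv_div p p', ← inv_div (1 - p) (1 - p'), Real.log_inv, Real.log_inv]
  have h3 : p' * Real.log (p / p') < p' * (p / p' - 1) := by gcongr
  have h4 : (1 - p') * Real.log ((1 - p) / (1 - p'))
      ≤ (1 - p') * ((1 - p) / (1 - p') - 1) :=
    mul_le_mul_of_nonneg_left h2 (by linarith)
  have h5 : p' * (p / p' - 1) = p - p' := by field_simp
  have h6 : (1 - p') * ((1 - p) / (1 - p') - 1) = p' - p := by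
    have : 1 - p' ≠ 0 := by linarith
    field_simp
    ring
  linarith

/-- A frequency that does not converge to `p` frequently lies beyond some `p' ≠ p`. -/
theorem exists_frequently_of_not_tendsto {f : ℕ → ℝ} (h0 : ∀ n, 0 ≤ f n) (h1 : ∀ n, f n ≤ 1)
    {p : ℝ} (hp : 0 < p) (hp1 : p < 1) (h : ¬ Tendsto f atTop (𝓝 p)) :
    ∃ p', 0 < p' ∧ p' < 1 ∧ p' ≠ p ∧
      ∃ᶠ n in atTop, (p < p' ∧ p' ≤ f n) ∨ (p' < p ∧ f n ≤ p') := by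
  rw [Metric.tendsto_nhds] at h
  push Not at h
  obtain ⟨ε, hε, hf⟩ := h
  have h2 : ∃ᶠ n in atTop, p + ε ≤ f n ∨ f n ≤ p - ε := by
    refine hf.mono fun n hn => ?_
    rw [Real.dist_eq, le_abs] at hn
    rcases hn with hn | hn
    · left; linarith
    · right; linarith
  rcases frequently_or_distrib.1 h2 with h3 | h3
  · obtain ⟨n, hn⟩ := h3.exists
    -- Half of ε keeps p' strictly below 1, as p + ε ≤ f n ≤ 1 for some n.
    refine ⟨p + ε / 2, by linarith, by linarith [h1 n], by linarith, h3.mono fun n hn => ?_⟩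
    left; constructor <;> linarith
  · obtain ⟨n, hn⟩ := h3.exists
    refine ⟨p - ε / 2, by linarith [h0 n], by linarith, by linarith, h3.mono fun n hn => ?_⟩
    right; constructor <;> linarith

end Probability

/-! ### Compression to the ideal length, and below it without normality. -/

section Compression

variable {A : Type*} [Fintype A]

/-- There is a lossless compressor whose output is asymptotically at most the ideal code
length. -/
theorem exists_lossless_le_info [Nonempty A] {α : A → ℝ} (hα : IsPosProb α) {ε : ℝ}
    (hε : 0 < ε) :
    ∃ (r : ℕ) (C : FSC A r), C.IsLossless ∧ ∀ S : ℕ → A, ∀ᶠ n : ℕ in atTop,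
      ((C.output (pre S n)).length : ℝ) ≤ info α S n + ε * n := by
  -- Single symbols suffice: the ideal length for the measure on blocks of length 1 is exactly
  -- `info`.
  obtain ⟨r, C, K, hC, hK⟩ := exists_lossless_le one_pos (hα.block 1) (half_pos hε)
  refine ⟨r, C, hC, fun S => ?_⟩
  filter_upwards [tendsto_natCast_atTop_atTop.eventually_ge_atTop (K / (ε / 2))] with n hn
  have h := hK S n
  rw [sum_logb_prod_block hα.1, mul_one] at h
  rw [div_le_iff₀ (half_pos hε)] at hn
  linarith

/-- A sequence that is not `α`-normal can frequently be compressed below the ideal code length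
with respect to `α`. -/
theorem exists_lossless_le_of_not_isNormal [Nontrivial A] {α : A → ℝ} (hα : IsPosProb α)
    {S : ℕ → A} (hS : ¬ IsNormal α S) :
    ∃ δ : ℝ, 0 < δ ∧ ∃ (r : ℕ) (C : FSC A r), C.IsLossless ∧ ∃ᶠ n : ℕ in atTop,
      ((C.output (pre S n)).length : ℝ) ≤ info α S n - δ * n := by
  classical
  simp only [IsNormal, IsBlockNormal, not_forall] at hS
  obtain ⟨ℓ, hℓ, x₀, hx₀⟩ := hS
  have : Nonempty (Fin ℓ) := ⟨⟨0, hℓ⟩⟩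
  let P : (Fin ℓ → A) → ℝ := fun x => ∏ i, α (x i)
  have hP : IsPosProb P := hα.block ℓ
  set p := P x₀ with hp_def
  have hp : 0 < p := hP.1 x₀
  have hp1 : p < 1 := hP.lt_one x₀
  obtain ⟨p', hp', hp1', hne, hfreq⟩ := exists_frequently_of_not_tendsto
    (fun n => blockFreq_nonneg S n x₀) (fun n => blockFreq_le_one S n x₀) hp hp1 hx₀
  have h1p : 0 < 1 - p := by linarith
  have h1p' : 0 < 1 - p' := by linarith
  set a := Real.log (p' / p) with ha
  set b := Real.log ((1 - p') / (1 - p)) with hb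
  set D := p' * a + (1 - p') * b with hD_def
  have hD : 0 < D := bernoulli_relEntropy_pos hp hp1 hp' hp1' hne
  have hlog2 : 0 < Real.log 2 := Real.log_pos (by norm_num)
  -- All blocks other than x₀ are rescaled by one factor, so the log-likelihood gain over P depends
  -- only on the frequency of x₀.
  let q : (Fin ℓ → A) → ℝ := fun x => if x = x₀ then p' else P x * ((1 - p') / (1 - p))
  have hq : IsPosProb q := by
    refine ⟨fun x => ?_, ?_⟩
    · have := hP.1 x
      simp only [q]
      split_ifs
      · exact hp'
      · positivity
    · have h1 : ∑ x ∈ Finset.univ.erase x₀, P x = 1 - p := by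
        rw [eq_sub_iff_add_eq, Finset.sum_erase_add _ _ (Finset.mem_univ x₀), hP.2]
      rw [← Finset.sum_erase_add _ _ (Finset.mem_univ x₀),
        Finset.sum_congr rfl (g := fun x => P x * ((1 - p') / (1 - p)))
          fun x hx => if_neg (Finset.ne_of_mem_erase hx), ← Finset.sum_mul, h1]
      simp only [q, if_pos]
      field_simp
      ring
  have hlogq : ∀ x, -Real.logb 2 (q x) = -Real.logb 2 (P x)
      - (b + (a - b) * if x = x₀ then 1 else 0) / Real.log 2 := by
    intro x
    simp only [Real.logb, q]
    split_ifs with hx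
    · rw [hx, ← hp_def, ha, Real.log_div hp'.ne' hp.ne']; ring
    · rw [Real.log_mul (hP.1 x).ne' (div_pos h1p' h1p).ne', ← hb]; ring
  set δ := D / Real.log 2 with hδ
  have hδ0 : 0 < δ := div_pos hD hlog2
  have hℓ' : (0 : ℝ) < ℓ := by exact_mod_cast hℓ
  obtain ⟨r, C, K, hC, hK⟩ := exists_lossless_le hℓ hq (half_pos hδ0)
  -- Of the gain δ per block, δ/2 pays for the compressor's excess and δ/4 for the constant K;
  -- division by ℓ converts to symbols.
  refine ⟨δ / 4 / ℓ, by positivity, r, C, hC, ?_⟩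
  have htend : Tendsto (fun n : ℕ => n * ℓ) atTop atTop := tendsto_id.atTop_mul_const' hℓ
  refine htend.frequently ((hfreq.and_eventually
    (tendsto_natCast_atTop_atTop.eventually_ge_atTop (K / (δ / 4)))).mono fun n hn => ?_)
  obtain ⟨hf, hn⟩ := hn
  rw [div_le_iff₀ (by positivity)] at hn
  refine (hK S n).trans ?_
  set f := blockFreq S n x₀
  -- The gain is affine in f with value D at p', and its slope has the sign of p' - p; going beyond
  -- p' only increases it.
  have hgain : D ≤ b + (a - b) * f := by
    have h1 : 0 ≤ (a - b) * (f - p') := by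
      rcases hf with ⟨h2, h3⟩ | ⟨h2, h3⟩
      · have ha0 : 0 < a := Real.log_pos ((one_lt_div hp).2 h2)
        have hb0 : b < 0 := Real.log_neg (div_pos h1p' h1p) ((div_lt_one h1p).2 (by linarith))
        exact mul_nonneg (by linarith) (by linarith)
      · have ha0 : a < 0 := Real.log_neg (div_pos hp' hp) ((div_lt_one hp).2 h2)
        have hb0 : 0 < b := Real.log_pos ((one_lt_div h1p).2 (by linarith))
        exact mul_nonneg_of_nonpos_of_nonpos (by linarith) (by linarith)
    have h2 : b + (a - b) * f = D + (a - b) * (f - p') := by rw [hD_def]; ring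
    linarith
  have hsum : ∑ j ∈ Finset.range n, -Real.logb 2 (q (block S ℓ j))
      = info α S (n * ℓ) - n * ((b + (a - b) * f) / Real.log 2) := by
    simp only [hlogq]
    rw [Finset.sum_sub_distrib, sum_logb_prod_block hα.1, ← Finset.sum_div,
      Finset.sum_add_distrib, ← Finset.mul_sum,
      sum_block_eq S n fun x => if x = x₀ then 1 else 0]
    simp only [Finset.sum_const, Finset.card_range, nsmul_eq_mul, mul_ite, mul_one, mul_zero,
      Finset.sum_ite_eq', Finset.mem_univ, if_true]
    ring
  have h3 : n * δ ≤ n * ((b + (a - b) * f) / Real.log 2) := by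
    rw [hδ]; gcongr
  have h4 : δ / 4 / ℓ * (n * ℓ : ℕ) = δ / 4 * n := by
    push_cast; field_simp
  rw [hsum, h4]
  linarith

end Compression

/-! ### Ideal length of pairs and the mutual dimension. -/

section Pairs

variable {A : Type*}

theorem pre_pairSeq (S T : ℕ → A) (n : ℕ) :
    pre (pairSeq S T) n = (pre S n).zip (pre T n) := by
  simp [pre, pairSeq, List.zip_map']

/-- The logarithm of the product measure splits pointwise, whatever the joint behaviour of the two
sequences. -/
theorem info_pairSeq {α β : A → ℝ} (hα : ∀ a, 0 < α a) (hβ : ∀ a, 0 < β a) (S T : ℕ → A)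
    (n : ℕ) : info (prodProb α β) (pairSeq S T) n = info α S n + info β T n := by
  simp only [info, prodProb, pairSeq]
  rw [← Finset.sum_add_distrib]
  refine Finset.sum_congr rfl fun i _ => ?_
  rw [Real.logb_mul (hα _).ne' (hβ _).ne']
  ring

variable [Fintype A]

theorem mutualRho_mul_normalizer (r t n : ℕ) (S T : ℕ → A) :
    mutualRho r t (pre S n) (pre T n) * normalizer A n
      = rho t (pre S n) * normalizer A n + rho t (pre T n) * normalizer A n
        - jointRho r (pre S n) (pre T n) * normalizer A n := by
  rw [mutualRho]; ring

theorem logb_card_pos [Nontrivial A] : 0 < Real.logb 2 (Fintype.card A) :=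
  Real.logb_pos (by norm_num) (by exact_mod_cast Fintype.one_lt_card)

theorem normalizer_pos [Nontrivial A] {n : ℕ} (hn : 0 < n) : 0 < normalizer A n :=
  mul_pos (by exact_mod_cast hn) logb_card_pos

theorem rho_mul_normalizer_le [Nontrivial A] {r t : ℕ} (hrt : r ≤ t) {C : FSC A r}
    (hC : C.IsLossless) (S : ℕ → A) {n : ℕ} (hn : 0 < n) :
    rho t (pre S n) * normalizer A n ≤ (C.output (pre S n)).length := by
  rw [← le_div_iff₀ (normalizer_pos hn)]
  have hr : 1 ≤ r := C.start.pos
  refine (rho_anti hr hrt _).trans (((isLeast_rho hr _).2 ⟨C, hC, rfl⟩).trans_eq ?_)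
  rw [ratio, length_pre]

theorem jointRho_mul_normalizer_le [Nontrivial A] {r t : ℕ} (hrt : r ≤ t) {C : FSC (A × A) r}
    (hC : C.IsLossless) (S T : ℕ → A) {n : ℕ} (hn : 0 < n) :
    jointRho t (pre S n) (pre T n) * normalizer A n
      ≤ (C.output (pre (pairSeq S T) n)).length := by
  rw [← le_div_iff₀ (normalizer_pos hn)]
  have hr : 1 ≤ r := C.start.pos
  refine (jointRho_anti hr hrt _ _).trans
    (((isLeast_jointRho hr _ _).2 ⟨C, hC, rfl⟩).trans_eq ?_)
  rw [jointRatio, length_pre, pre_pairSeq]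

/-- The minimizing compressor varies with n, so the lower bound has to be uniform over compressors.
-/
theorem IsNormal.eventually_info_le_rho [Nontrivial A] {α : A → ℝ} (hα : IsPosProb α)
    {S : ℕ → A} (hS : IsNormal α S) {r : ℕ} (hr : 1 ≤ r) {ε : ℝ} (hε : 0 < ε) :
    ∀ᶠ n : ℕ in atTop, info α S n ≤ rho r (pre S n) * normalizer A n + ε * n := by
  filter_upwards [hS.eventually_info_le hα r hε, eventually_gt_atTop 0] with n h hn
  obtain ⟨C, hC, hx⟩ := (isLeast_rho hr (pre S n)).1
  rw [hx, ratio, length_pre, div_mul_cancel₀ _ (normalizer_pos hn).ne']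
  exact h C hC

theorem IsNormal.eventually_info_le_jointRho [Nontrivial A] {α : A × A → ℝ}
    (hα : IsPosProb α) {S T : ℕ → A} (hS : IsNormal α (pairSeq S T)) {r : ℕ} (hr : 1 ≤ r)
    {ε : ℝ} (hε : 0 < ε) :
    ∀ᶠ n : ℕ in atTop, info α (pairSeq S T) n
      ≤ jointRho r (pre S n) (pre T n) * normalizer A n + ε * n := by
  filter_upwards [hS.eventually_info_le hα r hε, eventually_gt_atTop 0] with n h hn
  obtain ⟨C, hC, hx⟩ := (isLeast_jointRho hr (pre S n) (pre T n)).1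
  rw [hx, jointRatio, length_pre, div_mul_cancel₀ _ (normalizer_pos hn).ne', ← pre_pairSeq]
  exact h C hC

/-- One fixed compressor serves every larger t, since unreachable states can be added. -/
theorem exists_eventually_rho_le_info [Nontrivial A] {α : A → ℝ} (hα : IsPosProb α)
    (S : ℕ → A) {ε : ℝ} (hε : 0 < ε) :
    ∃ t₀ : ℕ, ∀ t, t₀ ≤ t → ∀ᶠ n : ℕ in atTop,
      rho t (pre S n) * normalizer A n ≤ info α S n + ε * n := by
  obtain ⟨r, C, hC, h⟩ := exists_lossless_le_info hα hε
  refine ⟨r, fun t ht => ?_⟩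
  filter_upwards [h S, eventually_gt_atTop 0] with n h hn
  exact (rho_mul_normalizer_le ht hC S hn).trans h

theorem exists_eventually_jointRho_le_info [Nontrivial A] {α : A × A → ℝ} (hα : IsPosProb α)
    (S T : ℕ → A) {ε : ℝ} (hε : 0 < ε) :
    ∃ r₀ : ℕ, ∀ r, r₀ ≤ r → ∀ᶠ n : ℕ in atTop,
      jointRho r (pre S n) (pre T n) * normalizer A n ≤ info α (pairSeq S T) n + ε * n := by
  obtain ⟨r, C, hC, h⟩ := exists_lossless_le_info hα hε
  refine ⟨r, fun t ht => ?_⟩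
  filter_upwards [h (pairSeq S T), eventually_gt_atTop 0] with n h hn
  exact (jointRho_mul_normalizer_le ht hC S T hn).trans h

theorem le_upperMutualRho_of_frequently {r t : ℕ} (hr : 1 ≤ r) (ht : 1 ≤ t) {S T : ℕ → A} {c : ℝ}
    (h : ∃ᶠ n in atTop, c ≤ mutualRho r t (pre S n) (pre T n)) : c ≤ upperMutualRho r t S T := by
  obtain ⟨B, hB⟩ := exists_abs_mutualRho_le A
  exact le_limsup_of_frequently_le h (isBoundedUnder_of ⟨B, fun n => (hB r t hr ht S T n).2⟩)

theorem upperMutualRho_le_of_eventually {r t : ℕ} (hr : 1 ≤ r) (ht : 1 ≤ t) {S T : ℕ → A} {c : ℝ}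
    (h : ∀ᶠ n in atTop, mutualRho r t (pre S n) (pre T n) ≤ c) : upperMutualRho r t S T ≤ c := by
  obtain ⟨B, hB⟩ := exists_abs_mutualRho_le A
  exact limsup_le_of_le
    (isBoundedUnder_of ⟨-B, fun n => (hB r t hr ht S T n).1⟩).isCoboundedUnder_le h

variable [Nontrivial A]

theorem div_logb_le_of_mul_le {x c : ℝ} {n : ℕ} (hn : 0 < n)
    (h : c * n ≤ x * normalizer A n) : c / Real.logb 2 (Fintype.card A) ≤ x := by
  have h2 : (0 : ℝ) < n := by exact_mod_cast hn
  rw [div_le_iff₀ logb_card_pos]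
  refine le_of_mul_le_mul_right (h.trans_eq ?_) h2
  rw [normalizer]; ring

theorem le_div_logb_of_le_mul {x c : ℝ} {n : ℕ} (hn : 0 < n)
    (h : x * normalizer A n ≤ c * n) : x ≤ c / Real.logb 2 (Fintype.card A) := by
  have h2 : (0 : ℝ) < n := by exact_mod_cast hn
  rw [le_div_iff₀ logb_card_pos]
  refine le_of_mul_le_mul_right (Eq.trans_le ?_ h) h2
  rw [normalizer]; ring

variable {α β : A → ℝ} {S T : ℕ → A}

/-- Coding the pair with the product measure costs about the sum of the two ideal lengths, and
neither normal sequence alone compresses below its own. -/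
theorem upperMutualDim_nonneg (hα : IsPosProb α) (hβ : IsPosProb β) (hS : IsNormal α S)
    (hT : IsNormal β T) : 0 ≤ upperMutualDim S T := by
  refine le_of_forall_pos_sub_le fun ε hε => ?_
  -- Three estimates each lose c per symbol; the factor log k undoes the normalization.
  set c := ε * Real.logb 2 (Fintype.card A) / 3 with hc
  have hlk := logb_card_pos (A := A)
  have hc0 : 0 < c := by positivity
  obtain ⟨r₀, hr₀⟩ := exists_eventually_jointRho_le_info (hα.prodProb hβ) S T hc0
  refine ge_of_tendsto (tendsto_upperMutualDim S T) ?_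
  filter_upwards [eventually_ge_atTop r₀, eventually_ge_atTop 1] with r hr hr1
  refine ge_of_tendsto (tendsto_innerUpper S T hr1) ?_
  filter_upwards [eventually_ge_atTop 1] with t ht
  refine le_upperMutualRho_of_frequently hr1 ht (Eventually.frequently ?_)
  filter_upwards [hr₀ r hr, hS.eventually_info_le_rho hα ht hc0,
    hT.eventually_info_le_rho hβ ht hc0, eventually_gt_atTop 0] with n h1 h2 h3 hn
  rw [info_pairSeq hα.1 hβ.1] at h1
  have h4 : 0 - ε = -(3 * c) / Real.logb 2 (Fintype.card A) := by
    rw [hc]; field_simp; ring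
  rw [h4]
  refine div_logb_le_of_mul_le hn ?_
  rw [mutualRho_mul_normalizer]
  linarith

/-- Each sequence can be coded near its ideal length, and normality of the pair forbids joint
compression below the sum. The thresholds on t do not depend on r, in keeping with the order of the
limits. -/
theorem upperMutualDim_nonpos (hα : IsPosProb α) (hβ : IsPosProb β)
    (hST : IsNormal (prodProb α β) (pairSeq S T)) : upperMutualDim S T ≤ 0 := by
  refine le_of_forall_pos_le_add fun ε hε => ?_
  set c := ε * Real.logb 2 (Fintype.card A) / 3 with hc
  have hlk := logb_card_pos (A := A)
  have hc0 : 0 < c := by positivity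
  obtain ⟨t₁, ht₁⟩ := exists_eventually_rho_le_info hα S hc0
  obtain ⟨t₂, ht₂⟩ := exists_eventually_rho_le_info hβ T hc0
  refine le_of_tendsto (tendsto_upperMutualDim S T) ?_
  filter_upwards [eventually_ge_atTop 1] with r hr
  refine le_of_tendsto (tendsto_innerUpper S T hr) ?_
  filter_upwards [eventually_ge_atTop 1, eventually_ge_atTop t₁, eventually_ge_atTop t₂]
    with t ht h1t h2t
  refine upperMutualRho_le_of_eventually hr ht ?_
  filter_upwards [ht₁ t h1t, ht₂ t h2t,
    hST.eventually_info_le_jointRho (hα.prodProb hβ) hr hc0, eventually_gt_atTop 0]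
    with n h1 h2 h3 hn
  rw [info_pairSeq hα.1 hβ.1] at h3
  have h4 : 0 + ε = 3 * c / Real.logb 2 (Fintype.card A) := by
    rw [hc]; field_simp; ring
  rw [h4]
  refine le_div_logb_of_le_mul hn ?_
  rw [mutualRho_mul_normalizer]
  linarith

/-- A compressor for the pair saves δn infinitely often, while the single sequences give back at
most δ/4 each; δ/2 per symbol survives for all large r and every t ≥ 1. -/
theorem upperMutualDim_pos (hα : IsPosProb α) (hβ : IsPosProb β) (hS : IsNormal α S)
    (hT : IsNormal β T) (hST : ¬ IsNormal (prodProb α β) (pairSeq S T)) :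
    0 < upperMutualDim S T := by
  obtain ⟨δ, hδ, r₀, C, hC, hfreq⟩ := exists_lossless_le_of_not_isNormal (hα.prodProb hβ) hST
  have hlk := logb_card_pos (A := A)
  refine lt_of_lt_of_le (div_pos (half_pos hδ) hlk) ?_
  refine ge_of_tendsto (tendsto_upperMutualDim S T) ?_
  filter_upwards [eventually_ge_atTop r₀, eventually_ge_atTop 1] with r hr hr1
  refine ge_of_tendsto (tendsto_innerUpper S T hr1) ?_
  filter_upwards [eventually_ge_atTop 1] with t ht
  refine le_upperMutualRho_of_frequently hr1 ht ?_
  have hδ4 : 0 < δ / 4 := by positivity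
  refine (hfreq.and_eventually ((hS.eventually_info_le_rho hα ht hδ4).and
    ((hT.eventually_info_le_rho hβ ht hδ4).and (eventually_gt_atTop 0)))).mono ?_
  rintro n ⟨h1, h2, h3, hn⟩
  have h4 := jointRho_mul_normalizer_le hr hC S T hn
  rw [info_pairSeq hα.1 hβ.1] at h1
  refine div_logb_le_of_mul_le hn ?_
  rw [mutualRho_mul_normalizer]
  linarith

end Pairs

end FSMutual

theorem theorem4 {A : Type*} [Fintype A] [Nontrivial A] (α₁ α₂ : A → ℝ)
    (hα₁ : FSMutual.IsPosProb α₁) (hα₂ : FSMutual.IsPosProb α₂) (R₁ R₂ : ℕ → A)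
    (hR₁ : FSMutual.IsNormal α₁ R₁) (hR₂ : FSMutual.IsNormal α₂ R₂) :
    FSMutual.IsNormal (FSMutual.prodProb α₁ α₂) (FSMutual.pairSeq R₁ R₂) ↔
      FSMutual.upperMutualDim R₁ R₂ = 0 := by
  refine ⟨fun h => le_antisymm (FSMutual.upperMutualDim_nonpos hα₁ hα₂ h)
    (FSMutual.upperMutualDim_nonneg hα₁ hα₂ hR₁ hR₂), fun h => ?_⟩
  by_contra hn
  exact (FSMutual.upperMutualDim_pos hα₁ hα₂ hR₁ hR₂ hn).ne' h
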